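/- Let $(M,\omega)$ be a connected 2-plectic manifold, i.e. $\omega$ is a closed $3$-form on the smooth manifold $M$ such that $v\mapsto\iota_v\omega$ is injective on every tangent space. Let $\mathfrak g$ be a finite-dimensional real Lie algebra and $\mathfrak g\to\mathfrak X(M)$, $x\mapsto v_x$, a Lie algebra morphism such that every $v_x$ is a Hamiltonian vector field, i.e. $-\iota_{v_x}\omega$ is the de Rham differential of some $1$-form. Fix $p\in M$ and let $[\omega_{3p}]_{\mathfrak g}\in H^3(\mathfrak g)$ be the Chevalley–Eilenberg class of the $3$-cocycle $\omega_{3p}(x,y,z)=\omega(v_x,v_y,v_z)|_p$. Let $\mathfrak h[1]\oplus\mathfrak g$ be a Lie 2-algebra ($\mathfrak h$ a finite-dimensional real vector space) whose binary bracket extends the Lie bracket of $\mathfrak g$ and which is minimal, i.e. has vanishing unary bracket. Thus $[x,h]$ ($x\in\mathfrak g$, $h\in\mathfrak h$) makes $\mathfrak h$ a representation of $\mathfrak g$, and the trinary bracket is a $3$-cocycle $c:\wedge^3\mathfrak g\to\mathfrak h$ for it. Let $[\mathfrak g,\mathfrak h]\subset\mathfrak h$ be the span of all $[x,h]$, let $\mathrm{pr}:\mathfrak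 h\to\mathfrak h/[\mathfrak g,\mathfrak h]$ be the projection to the quotient representation, and let $c_{red}=\mathrm{pr}\circ c$, which is a $3$-cocycle of $\mathfrak g$ with values in $\mathfrak h/[\mathfrak g,\mathfrak h]$. A moment map for $\mathfrak h[1]\oplus\mathfrak g$ is an $L_\infty$-morphism $(f_1,f_2)$ from $\mathfrak h[1]\oplus\mathfrak g$ to the Lie 2-algebra $L_\infty(M,\omega)$ such that $d(f_1(x))=-\iota_{v_x}\omega$ for all $x\in\mathfrak g$. Here $L_\infty(M,\omega)$ consists of the Hamiltonian $1$-forms in degree $0$ and $C^\infty(M)$ in degree $-1$, with unary bracket $d$, binary bracket $[\alpha,\beta]'=\iota_{v_\beta}\iota_{v_\alpha}\omega$ and trinary bracket $[\alpha,\beta,\gamma]'=-\omega(v_\alpha,v_\beta,v_\gamma)$ on Hamiltonian $1$-forms, where $d\alpha=-\iota_{v_\alpha}\omega$, all other brackets being zero. Assume $[\omega_{3p}]_{\mathfrak g}\neq0$. If $[c_{red}]_{\mathfrak g}=0$ in $H^3(\mathfrak g,\mathfrak h/[\mathfrak g,\mathfrak h])$, then there exists no moment map for $\mathfrak h[1]\oplus\mathfrak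 g$. -/

import Mathlib

open scoped Manifold ContDiff

noncomputable section

/-! ### Differential forms and vector fields on a manifold

`M` is a smooth manifold without boundary modelled on a real normed space `E`. -/

section Forms

variable (E : Type*) [NormedAddCommGroup E] [NormedSpace ℝ E]
  (M : Type*) [TopologicalSpace M] [ChartedSpace E M]

/-- Not necessarily smooth sections of `⋀ᵏ T*M`. -/
abbrev RawForm (k : ℕ) : Type _ :=
  (x : M) → TangentSpace 𝓘(ℝ, E) x [⋀^Fin k]→L[ℝ] ℝ

/-- The Lie algebra `𝔛(M)` of smooth vector fields (its Lie bracket is `VectorField.mlieBracket`). -/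
abbrev SmoothVectorField [IsManifold 𝓘(ℝ, E) ∞ M] : Type _ :=
  ContMDiffSection 𝓘(ℝ, E) E ∞ (fun x : M ↦ TangentSpace 𝓘(ℝ, E) x)

/-- The smooth functions `C^∞(M)`. -/
abbrev SmoothFunction : Type _ := ContMDiffMap 𝓘(ℝ, E) 𝓘(ℝ, ℝ) M ℝ ∞

variable {E M}

namespace RawForm

/-- The coordinate expression of `α` in the preferred chart `φ` at `x₀`, i.e. the pullback
`(φ⁻¹)^* α`, meaningful on the (open) target of `φ`. -/
def inChart {k : ℕ} (α : RawForm E M k) (x₀ : M) (y : E) : E [⋀^Fin k]→L[ℝ] ℝ :=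
  (α ((extChartAt 𝓘(ℝ, E) x₀).symm y)).compContinuousLinearMap
    (mfderiv 𝓘(ℝ, E) 𝓘(ℝ, E) (extChartAt 𝓘(ℝ, E) x₀).symm y)

/-- A form is smooth if all its coordinate expressions are. -/
def IsSmooth {k : ℕ} (α : RawForm E M k) : Prop :=
  ∀ x₀ : M, ContDiffOn ℝ ∞ (α.inChart x₀) (extChartAt 𝓘(ℝ, E) x₀).target

/-- The de Rham differential: at `x` it is the pullback by the chart `φ` at `x` of the exterior
derivative of the coordinate expression in `φ`. -/
def dR {k : ℕ} (α : RawForm E M k) : RawForm E M (k + 1) := fun x ↦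
  (extDeriv (α.inChart x) (extChartAt 𝓘(ℝ, E) x x)).compContinuousLinearMap
    (mfderiv 𝓘(ℝ, E) 𝓘(ℝ, E) (extChartAt 𝓘(ℝ, E) x) x)

/-- The contraction `ι_v α = α(v, ⋯)`. -/
def contract {k : ℕ} (v : (x : M) → TangentSpace 𝓘(ℝ, E) x) (α : RawForm E M (k + 1)) :
    RawForm E M k := fun x ↦
  ContinuousAlternatingMap.curryLeft (E := E) (F := ℝ) (α x) (v x)

lemma inChart_add {k : ℕ} (α β : RawForm E M k) (x₀ : M) :
    (α + β).inChart x₀ = α.inChart x₀ + β.inChart x₀ := by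
  ext y w; rfl

lemma inChart_smul {k : ℕ} (c : ℝ) (α : RawForm E M k) (x₀ : M) :
    (c • α).inChart x₀ = c • α.inChart x₀ := by
  ext y w; rfl

lemma IsSmooth.differentiableAt {k : ℕ} {α : RawForm E M k} (hα : α.IsSmooth) (x : M) :
    DifferentiableAt ℝ (α.inChart x) (extChartAt 𝓘(ℝ, E) x x) :=
  ((hα x).contDiffAt (extChartAt_target_mem_nhds x)).differentiableAt (by simp)

lemma dR_add {k : ℕ} {α β : RawForm E M k} (hα : α.IsSmooth) (hβ : β.IsSmooth) :
    (α + β).dR = α.dR + β.dR := by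
  funext x
  simp only [dR, inChart_add, extDeriv_add (hα.differentiableAt x) (hβ.differentiableAt x)]
  ext w; rfl

lemma dR_smul {k : ℕ} (c : ℝ) (α : RawForm E M k) : (c • α).dR = c • α.dR := by
  funext x
  simp only [dR, inChart_smul, extDeriv_smul]
  ext w; rfl

lemma contract_apply {k : ℕ} (v : (x : M) → TangentSpace 𝓘(ℝ, E) x) (α : RawForm E M (k + 1))
    (x : M) (w : Fin k → TangentSpace 𝓘(ℝ, E) x) :
    contract v α x w = α x (Matrix.vecCons (v x) w) := rfl

end RawForm

variable (E M) in
/-- The space `Ωᵏ(M)` of smooth `k`-forms. -/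
def SmoothForm (k : ℕ) : Submodule ℝ (RawForm E M k) where
  carrier := {α | α.IsSmooth}
  add_mem' {α β} hα hβ x₀ := by
    rw [RawForm.inChart_add]; exact (hα x₀).add (hβ x₀)
  zero_mem' x₀ := contDiffOn_const (c := (0 : E [⋀^Fin k]→L[ℝ] ℝ)) |>.congr fun y _ ↦ by
    ext w; rfl
  smul_mem' c α hα x₀ := by
    rw [RawForm.inChart_smul]; exact contDiffOn_const.smul (hα x₀)

/-- The de Rham differential of a smooth function, as a `1`-form. -/
def SmoothFunction.dR (f : SmoothFunction E M) : RawForm E M 1 := fun x ↦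
  ContinuousAlternatingMap.ofSubsingleton ℝ (TangentSpace 𝓘(ℝ, E) x) ℝ (0 : Fin 1)
    (mfderiv 𝓘(ℝ, E) 𝓘(ℝ, ℝ) f x : TangentSpace 𝓘(ℝ, E) x →L[ℝ] ℝ)

end Forms

/-! ### 2-plectic manifolds and their Lie 2-algebra of observables -/

section TwoPlectic

variable (E : Type*) [NormedAddCommGroup E] [NormedSpace ℝ E]
  (M : Type*) [TopologicalSpace M] [ChartedSpace E M]

/-- A 2-plectic form: a smooth closed `3`-form such that `v ↦ ι_v ω` is injective on every
tangent space. -/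
structure TwoPlecticForm where
  form : RawForm E M 3
  smooth : form ∈ SmoothForm E M 3
  closed : form.dR = 0
  nondegenerate : ∀ (x : M) (v : TangentSpace 𝓘(ℝ, E) x),
    (∀ u w : TangentSpace 𝓘(ℝ, E) x, form x ![v, u, w] = 0) → v = 0

variable {E M}

namespace TwoPlecticForm

variable [IsManifold 𝓘(ℝ, E) ∞ M] (Ω : TwoPlecticForm E M)

/-- `α` is a Hamiltonian `1`-form and `v` is a Hamiltonian vector field of it: `dα = -ι_v ω`. -/
def IsHamiltonianPair (α : RawForm E M 1) (v : SmoothVectorField E M) : Prop :=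
  α ∈ SmoothForm E M 1 ∧ α.dR = -RawForm.contract v Ω.form

/-- The space `Ω¹_Ham(M)` of Hamiltonian `1`-forms. -/
def hamiltonianForms : Submodule ℝ (RawForm E M 1) where
  carrier := {α | ∃ v : SmoothVectorField E M, Ω.IsHamiltonianPair α v}
  add_mem' := by
    rintro α β ⟨v, hα, hv⟩ ⟨w, hβ, hw⟩
    refine ⟨v + w, add_mem hα hβ, ?_⟩
    rw [RawForm.dR_add hα hβ, hv, hw]
    funext x; ext u
    have h : RawForm.contract (v + w) Ω.form x u =
        RawForm.contract v Ω.form x u + RawForm.contract w Ω.form x u :=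
      (Ω.form x).map_vecCons_add u (v x) (w x)
    change -RawForm.contract v Ω.form x u + -RawForm.contract w Ω.form x u =
      -RawForm.contract (v + w) Ω.form x u
    rw [h]; ring
  zero_mem' := by
    refine ⟨0, zero_mem _, ?_⟩
    have h0 : (0 : RawForm E M 1).dR = 0 := by
      simpa using RawForm.dR_smul 0 (0 : RawForm E M 1)
    rw [h0]
    funext x; ext u
    have h : RawForm.contract (0 : SmoothVectorField E M) Ω.form x u = 0 :=
      (Ω.form x).map_coord_zero (0 : Fin 3) rfl
    change (0 : ℝ) = -RawForm.contract (0 : SmoothVectorField E M) Ω.form x u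
    rw [h]; ring
  smul_mem' := by
    rintro c α ⟨v, hα, hv⟩
    refine ⟨c • v, Submodule.smul_mem _ c hα, ?_⟩
    rw [RawForm.dR_smul, hv]
    funext x; ext u
    have h : RawForm.contract (c • v) Ω.form x u = c * RawForm.contract v Ω.form x u :=
      (Ω.form x).map_vecCons_smul u c (v x)
    change c * -RawForm.contract v Ω.form x u = -RawForm.contract (c • v) Ω.form x u
    rw [h]; ring

/-- The Hamiltonian vector field of a Hamiltonian `1`-form. -/
def hamiltonianVF (α : Ω.hamiltonianForms) : SmoothVectorField E M := α.2.choose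

lemma isHamiltonianPair_hamiltonianVF (α : Ω.hamiltonianForms) :
    Ω.IsHamiltonianPair α (Ω.hamiltonianVF α) := α.2.choose_spec

/-- By nondegeneracy, the Hamiltonian vector field is unique. -/
lemma hamiltonianVF_unique (α : Ω.hamiltonianForms) {v : SmoothVectorField E M}
    (hv : Ω.IsHamiltonianPair α v) : Ω.hamiltonianVF α = v := by
  have h := (Ω.isHamiltonianPair_hamiltonianVF α).2.symm.trans hv.2
  rw [neg_inj] at h
  ext x
  rw [← sub_eq_zero]
  refine Ω.nondegenerate x _ fun u w ↦ ?_
  have hx : Ω.form x ![Ω.hamiltonianVF α x, u, w] = Ω.form x ![v x, u, w] :=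
    congrArg (fun β : TangentSpace 𝓘(ℝ, E) x [⋀^Fin 2]→L[ℝ] ℝ ↦ β ![u, w]) (congrFun h x)
  have h1 := (Ω.form x).map_vecCons_add ![u, w] (Ω.hamiltonianVF α x - v x) (v x)
  rw [sub_add_cancel] at h1
  exact add_eq_right.1 (h1.symm.trans hx)

/-- The sign `ζ(k) = -(-1)^{k(k+1)/2}`. -/
def zeta (k : ℕ) : ℝ := -(-1) ^ (k * (k + 1) / 2)

/-- The binary bracket `[α, β]' = ζ(2) ι_{v_β} ι_{v_α} ω` of `L_∞(M, ω)` on degree `0`. (On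
elements of negative total degree this bracket vanishes.) -/
def bracketTwo (α β : Ω.hamiltonianForms) : RawForm E M 1 :=
  zeta 2 • RawForm.contract (Ω.hamiltonianVF β) (RawForm.contract (Ω.hamiltonianVF α) Ω.form)

/-- The trinary bracket `[α, β, γ]' = ζ(3) ι_{v_γ} ι_{v_β} ι_{v_α} ω` of `L_∞(M, ω)` on
degree `0`, a function on `M`. -/
def bracketThree (α β γ : Ω.hamiltonianForms) (x : M) : ℝ :=
  zeta 3 * Ω.form x ![Ω.hamiltonianVF α x, Ω.hamiltonianVF β x, Ω.hamiltonianVF γ x]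

end TwoPlecticForm

/-- A Lie algebra morphism `𝔤 → 𝔛(M)`, `x ↦ v_x`, with values in Hamiltonian vector fields. -/
structure HamiltonianAction [IsManifold 𝓘(ℝ, E) ∞ M] (Ω : TwoPlecticForm E M)
    (𝔤 : Type*) [LieRing 𝔤] [LieAlgebra ℝ 𝔤] where
  field : 𝔤 →ₗ[ℝ] SmoothVectorField E M
  map_lie : ∀ (x y : 𝔤) (q : M),
    field ⁅x, y⁆ q = VectorField.mlieBracket 𝓘(ℝ, E) (field x) (field y) q
  hamiltonian : ∀ x : 𝔤, ∃ α : RawForm E M 1, Ω.IsHamiltonianPair α (field x)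

/-- The `3`-cochain `ω_{3p}(x, y, z) = ω(v_x, v_y, v_z)|_p` on `𝔤`. -/
def HamiltonianAction.omegaThree [IsManifold 𝓘(ℝ, E) ∞ M] {Ω : TwoPlecticForm E M}
    {𝔤 : Type*} [LieRing 𝔤] [LieAlgebra ℝ 𝔤] (A : HamiltonianAction Ω 𝔤) (p : M) :
    𝔤 [⋀^Fin 3]→ₗ[ℝ] ℝ :=
  (Ω.form p).toAlternatingMap.compLinearMap
    { toFun := fun x ↦ A.field x p
      map_add' := fun x y ↦ by rw [map_add]; rfl
      map_smul' := fun c x ↦ by rw [map_smul]; rfl }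

end TwoPlectic

/-! ### Lie algebra cohomology in degree 3 -/

attribute [local instance 100] LieRing.ofAssociativeRing

section CE

variable {𝔤 : Type*} [LieRing 𝔤] [LieAlgebra ℝ 𝔤] {V : Type*} [AddCommGroup V] [Module ℝ V]

variable (𝔤) in
/-- The trivial representation of `𝔤` on `ℝ`. -/
def trivialRep : 𝔤 →ₗ⁅ℝ⁆ Module.End ℝ ℝ := 0

/-- `θ` is a `3`-cocycle of the Chevalley–Eilenberg complex of `𝔤` with values in the
representation `ρ`. -/
def IsCECocycle (ρ : 𝔤 →ₗ⁅ℝ⁆ Module.End ℝ V) (θ : 𝔤 [⋀^Fin 3]→ₗ[ℝ] V) : Prop :=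
  ∀ x y z u : 𝔤,
    ρ x (θ ![y, z, u]) - ρ y (θ ![x, z, u]) + ρ z (θ ![x, y, u]) - ρ u (θ ![x, y, z])
      - θ ![⁅x, y⁆, z, u] + θ ![⁅x, z⁆, y, u] - θ ![⁅x, u⁆, y, z]
      - θ ![⁅y, z⁆, x, u] + θ ![⁅y, u⁆, x, z] - θ ![⁅z, u⁆, x, y] = 0

/-- `θ` is the Chevalley–Eilenberg differential of a `2`-cochain with values in `ρ`; for a
cocycle `θ` this says that its class in `H³(𝔤, V)` vanishes. -/
def IsCECoboundary (ρ : 𝔤 →ₗ⁅ℝ⁆ Module.End ℝ V) (θ : 𝔤 [⋀^Fin 3]→ₗ[ℝ] V) : Prop :=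
  ∃ η : 𝔤 [⋀^Fin 2]→ₗ[ℝ] V, ∀ x y z : 𝔤,
    θ ![x, y, z] = ρ x (η ![y, z]) - ρ y (η ![x, z]) + ρ z (η ![x, y])
      - η ![⁅x, y⁆, z] + η ![⁅x, z⁆, y] - η ![⁅y, z⁆, x]

end CE

/-! ### Lie 2-algebras -/

/-- A Lie 2-algebra `𝔥[1] ⊕ 𝔤` (an `L_∞`-algebra concentrated in degrees `-1, 0`) whose binary
bracket on the Lie algebra `𝔤` is the given one: a unary bracket `δ`, the binary bracket
`act x h = [x, h] = -[h, x]`, the trinary bracket `tri`, and the higher Jacobi identities. -/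
structure LieTwoAlgebra (𝔤 𝔥 : Type*) [LieRing 𝔤] [LieAlgebra ℝ 𝔤]
    [AddCommGroup 𝔥] [Module ℝ 𝔥] where
  δ : 𝔥 →ₗ[ℝ] 𝔤
  act : 𝔤 →ₗ[ℝ] 𝔥 →ₗ[ℝ] 𝔥
  tri : 𝔤 [⋀^Fin 3]→ₗ[ℝ] 𝔥
  δ_act : ∀ x h, δ (act x h) = ⁅x, δ h⁆
  act_δ : ∀ h k, act (δ h) k = -act (δ k) h
  δ_tri : ∀ x y z, δ (tri ![x, y, z]) = -⁅⁅x, y⁆, z⁆ + ⁅⁅x, z⁆, y⁆ + ⁅x, ⁅y, z⁆⁆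
  tri_δ : ∀ h x y, tri ![δ h, x, y] = -act ⁅x, y⁆ h - act y (act x h) + act x (act y h)
  tri_jacobi : ∀ x y z u,
    act x (tri ![y, z, u]) - act y (tri ![x, z, u]) + act z (tri ![x, y, u])
        - act u (tri ![x, y, z]) =
      tri ![⁅x, y⁆, z, u] + tri ![y, ⁅x, z⁆, u] + tri ![y, z, ⁅x, u⁆]
        - tri ![x, ⁅y, z⁆, u] - tri ![x, z, ⁅y, u⁆] + tri ![x, y, ⁅z, u⁆]

namespace LieTwoAlgebra

variable {𝔤 𝔥 : Type*} [LieRing 𝔤] [LieAlgebra ℝ 𝔤] [AddCommGroup 𝔥] [Module ℝ 𝔥]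
  (L : LieTwoAlgebra 𝔤 𝔥)

/-- A Lie 2-algebra is minimal if its unary bracket vanishes. -/
def IsMinimal : Prop := L.δ = 0

/-- The subspace `[𝔤, 𝔥]` of `𝔥` spanned by all `[x, h]`. -/
def bracketSpan : Submodule ℝ 𝔥 := Submodule.span ℝ {k | ∃ x h, k = L.act x h}

lemma act_mem (x : 𝔤) (h : 𝔥) : L.act x h ∈ L.bracketSpan :=
  Submodule.subset_span ⟨x, h, rfl⟩

variable {L} in
lemma IsMinimal.act_lie (hL : L.IsMinimal) (x y : 𝔤) (h : 𝔥) :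
    L.act ⁅x, y⁆ h = L.act x (L.act y h) - L.act y (L.act x h) := by
  have h1 := L.tri_δ h x y
  rw [hL, LinearMap.zero_apply, L.tri.map_coord_zero (0 : Fin 3) rfl] at h1
  have h2 : L.act ⁅x, y⁆ h - (L.act x (L.act y h) - L.act y (L.act x h)) = 0 := by
    rw [← neg_eq_zero, h1]; abel
  exact sub_eq_zero.1 h2

variable {L} in
/-- The quotient representation of `𝔤` on `𝔥 / [𝔤, 𝔥]`, for a minimal Lie 2-algebra. -/
def IsMinimal.redRep (hL : L.IsMinimal) : 𝔤 →ₗ⁅ℝ⁆ Module.End ℝ (𝔥 ⧸ L.bracketSpan) where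
  toFun x := L.bracketSpan.mapQ L.bracketSpan (L.act x) fun h _ ↦ L.act_mem x h
  map_add' x y := by ext h; simp
  map_smul' c x := by ext h; simp
  map_lie' {x y} := by
    ext h
    simp [hL.act_lie, Ring.lie_def]

/-- The reduced cochain `c_red = pr ∘ c : ⋀³𝔤 → 𝔥 / [𝔤, 𝔥]`, where `c` is the trinary bracket. -/
def cRed : 𝔤 [⋀^Fin 3]→ₗ[ℝ] (𝔥 ⧸ L.bracketSpan) :=
  L.bracketSpan.mkQ.compAlternatingMap L.tri

lemma cRed_isCECocycle (hL : L.IsMinimal) : IsCECocycle hL.redRep L.cRed := by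
  intro x y z u
  have e1 : L.tri ![⁅x, z⁆, y, u] = -L.tri ![y, ⁅x, z⁆, u] := by
    rw [← L.tri.map_swap _ (show (0 : Fin 3) ≠ 1 by decide)]
    congr 1; ext i; fin_cases i <;> rfl
  have e2 : L.tri ![⁅y, z⁆, x, u] = -L.tri ![x, ⁅y, z⁆, u] := by
    rw [← L.tri.map_swap _ (show (0 : Fin 3) ≠ 1 by decide)]
    congr 1; ext i; fin_cases i <;> rfl
  have e3 (a b c : 𝔤) : L.tri ![a, b, c] = L.tri ![b, c, a] := by
    have h1 : L.tri ![a, b, c] = -L.tri ![b, a, c] := by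
      rw [← L.tri.map_swap _ (show (0 : Fin 3) ≠ 1 by decide)]
      congr 1; ext i; fin_cases i <;> rfl
    have h2 : L.tri ![b, a, c] = -L.tri ![b, c, a] := by
      rw [← L.tri.map_swap _ (show (1 : Fin 3) ≠ 2 by decide)]
      congr 1; ext i; fin_cases i <;> rfl
    rw [h1, h2, neg_neg]
  have e4 : L.tri ![⁅y, u⁆, x, z] = L.tri ![x, z, ⁅y, u⁆] := e3 _ _ _
  have e5 := e3 ⁅x, u⁆ y z
  have e6 := e3 ⁅z, u⁆ x y
  have h := congrArg L.bracketSpan.mkQ (L.tri_jacobi x y z u)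
  simp only [map_add, map_sub] at h
  change L.bracketSpan.mkQ (L.act x (L.tri ![y, z, u])) - L.bracketSpan.mkQ (L.act y (L.tri ![x, z, u]))
      + L.bracketSpan.mkQ (L.act z (L.tri ![x, y, u])) - L.bracketSpan.mkQ (L.act u (L.tri ![x, y, z]))
      - L.bracketSpan.mkQ (L.tri ![⁅x, y⁆, z, u]) + L.bracketSpan.mkQ (L.tri ![⁅x, z⁆, y, u])
      - L.bracketSpan.mkQ (L.tri ![⁅x, u⁆, y, z]) - L.bracketSpan.mkQ (L.tri ![⁅y, z⁆, x, u])
      + L.bracketSpan.mkQ (L.tri ![⁅y, u⁆, x, z]) - L.bracketSpan.mkQ (L.tri ![⁅z, u⁆, x, y]) = 0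
  rw [h, e1, e2, e4, e5, e6]
  simp only [map_neg]
  abel

end LieTwoAlgebra

/-! ### Moment maps -/

section MomentMap

variable {E : Type*} [NormedAddCommGroup E] [NormedSpace ℝ E]
  {M : Type*} [TopologicalSpace M] [ChartedSpace E M] [IsManifold 𝓘(ℝ, E) ∞ M]
  {𝔤 𝔥 : Type*} [LieRing 𝔤] [LieAlgebra ℝ 𝔤] [AddCommGroup 𝔥] [Module ℝ 𝔥]

/-- An `L_∞`-morphism `(f₁, f₂)` from `𝔥[1] ⊕ 𝔤` to `L_∞(M, ω)`. -/
structure LInftyMorphism (Ω : TwoPlecticForm E M) (L : LieTwoAlgebra 𝔤 𝔥) where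
  oneG : 𝔤 →ₗ[ℝ] Ω.hamiltonianForms
  oneH : 𝔥 →ₗ[ℝ] SmoothFunction E M
  two : 𝔤 [⋀^Fin 2]→ₗ[ℝ] SmoothFunction E M
  d_oneH : ∀ h : 𝔥, (oneH h).dR = (oneG (L.δ h) : RawForm E M 1)
  d_two : ∀ x y : 𝔤,
    (two ![x, y]).dR = (oneG ⁅x, y⁆ : RawForm E M 1) - Ω.bracketTwo (oneG x) (oneG y)
  two_δ : ∀ (h : 𝔥) (x : 𝔤), two ![L.δ h, x] = oneH (-L.act x h)
  one_tri : ∀ (x y z : 𝔤) (q : M),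
    oneH (L.tri ![x, y, z]) q - Ω.bracketThree (oneG x) (oneG y) (oneG z) q =
      two ![x, ⁅y, z⁆] q - two ![y, ⁅x, z⁆] q + two ![z, ⁅x, y⁆] q

/-- A homotopy moment map for `𝔥[1] ⊕ 𝔤`: an `L_∞`-morphism with `d(f₁(x)) = -ι_{v_x} ω`
for all `x ∈ 𝔤`. -/
structure MomentMap {Ω : TwoPlecticForm E M} (A : HamiltonianAction Ω 𝔤)
    (L : LieTwoAlgebra 𝔤 𝔥) extends LInftyMorphism Ω L where
  moment : ∀ x : 𝔤,
    (oneG x : RawForm E M 1).dR = -RawForm.contract (A.field x) Ω.form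

end MomentMap

end

/-!
A moment map for a minimal Lie 2-algebra makes `[ω_{3p}]` the image of `[c_red]` under a linear form.

Since the unary bracket `δ` vanishes, the identity relating `f₂(δh, x)` and `f₁([x, h])` says that
`f₁` kills `[𝔤, 𝔥]`. Hence `h ↦ f₁(h)(p)` descends to a linear form `φ` on `𝔥 / [𝔤, 𝔥]`
(`LInftyMorphism.evalRed`), on which moreover `𝔤` acts trivially (`IsMinimal.redRep_eq_zero`).
By nondegeneracy of `ω` the Hamiltonian vector field of `f₁(x)` is `v_x`, so the last identity of an
`L_∞`-morphism, evaluated at `p`, reads `ω_{3p} = d(f₂|_p) - φ ∘ c_red`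
(`MomentMap.omegaThree_apply`). If `c_red = dη` then `ω_{3p} = d(f₂|_p - φ ∘ η)` is a coboundary.
-/

/-- The quotient representation on `𝔥 / [𝔤, 𝔥]` is trivial. -/
lemma LieTwoAlgebra.IsMinimal.redRep_eq_zero {𝔤 𝔥 : Type*} [LieRing 𝔤] [LieAlgebra ℝ 𝔤]
    [AddCommGroup 𝔥] [Module ℝ 𝔥] {L : LieTwoAlgebra 𝔤 𝔥} (hL : L.IsMinimal) (x : 𝔤)
    (k : 𝔥 ⧸ L.bracketSpan) : hL.redRep x k = 0 := by
  obtain ⟨h, rfl⟩ := L.bracketSpan.mkQ_surjective k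
  exact (Submodule.Quotient.mk_eq_zero _).2 (L.act_mem x h)

section MomentMap

variable {E : Type*} [NormedAddCommGroup E] [NormedSpace ℝ E]
  {M : Type*} [TopologicalSpace M] [ChartedSpace E M]

/-- Evaluation of smooth functions at a point, as a linear form. -/
noncomputable def SmoothFunction.evalAt (p : M) : SmoothFunction E M →ₗ[ℝ] ℝ where
  toFun f := f p
  map_add' _ _ := rfl
  map_smul' _ _ := rfl

variable [IsManifold 𝓘(ℝ, E) ∞ M]
  {𝔤 𝔥 : Type*} [LieRing 𝔤] [LieAlgebra ℝ 𝔤] [AddCommGroup 𝔥] [Module ℝ 𝔥]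
  {Ω : TwoPlecticForm E M} {L : LieTwoAlgebra 𝔤 𝔥}

lemma LInftyMorphism.oneH_act (F : LInftyMorphism Ω L) (hL : L.IsMinimal) (x : 𝔤) (h : 𝔥) :
    F.oneH (L.act x h) = 0 := by
  have h1 := F.two_δ h x
  rw [hL, LinearMap.zero_apply, F.two.map_coord_zero (0 : Fin 2) rfl, map_neg] at h1
  exact neg_eq_zero.1 h1.symm

/-- The linear form on `𝔥 / [𝔤, 𝔥]` induced by `h ↦ f₁(h)(p)`. -/
noncomputable def LInftyMorphism.evalRed (F : LInftyMorphism Ω L) (hL : L.IsMinimal) (p : M) :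
    (𝔥 ⧸ L.bracketSpan) →ₗ[ℝ] ℝ :=
  L.bracketSpan.liftQ (SmoothFunction.evalAt p ∘ₗ F.oneH) <| Submodule.span_le.2 <| by
    rintro _ ⟨x, h, rfl⟩
    change SmoothFunction.evalAt p (F.oneH (L.act x h)) = 0
    rw [F.oneH_act hL, map_zero]

lemma MomentMap.hamiltonianVF_oneG {A : HamiltonianAction Ω 𝔤} (F : MomentMap A L) (x : 𝔤) :
    Ω.hamiltonianVF (F.oneG x) = A.field x :=
  Ω.hamiltonianVF_unique _
    ⟨(Ω.isHamiltonianPair_hamiltonianVF (F.oneG x)).1, F.moment x⟩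

/-- The cocycle `ω_{3p}` is cohomologous to minus the image of `c_red` under the linear form
induced by the moment map at `p`. -/
lemma MomentMap.omegaThree_apply {A : HamiltonianAction Ω 𝔤} (F : MomentMap A L)
    (hL : L.IsMinimal) (p : M) (x y z : 𝔤) :
    A.omegaThree p ![x, y, z] =
      F.two ![x, ⁅y, z⁆] p - F.two ![y, ⁅x, z⁆] p + F.two ![z, ⁅x, y⁆] p
        - F.evalRed hL p (L.cRed ![x, y, z]) := by
  have hω : A.omegaThree p ![x, y, z] =
      Ω.form p ![A.field x p, A.field y p, A.field z p] := by
    refine congrArg (Ω.form p) ?_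
    ext i; fin_cases i <;> rfl
  have hc : F.evalRed hL p (L.cRed ![x, y, z]) = F.oneH (L.tri ![x, y, z]) p := rfl
  have h := F.one_tri x y z p
  have hζ : TwoPlecticForm.zeta 3 = -1 := by norm_num [TwoPlecticForm.zeta]
  simp only [TwoPlecticForm.bracketThree, F.hamiltonianVF_oneG, hζ] at h
  rw [hω, hc]
  linarith

end MomentMap

theorem mainTheorem7
    {E : Type*} [NormedAddCommGroup E] [NormedSpace ℝ E] [FiniteDimensional ℝ E]
    {M : Type*} [TopologicalSpace M] [T2Space M] [SecondCountableTopology M] [ConnectedSpace M]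
    [ChartedSpace E M] [IsManifold (modelWithCornersSelf ℝ E) ∞ M]
    {𝔤 : Type*} [LieRing 𝔤] [LieAlgebra ℝ 𝔤] [FiniteDimensional ℝ 𝔤]
    {𝔥 : Type*} [AddCommGroup 𝔥] [Module ℝ 𝔥] [FiniteDimensional ℝ 𝔥]
    (Ω : TwoPlecticForm E M) (A : HamiltonianAction Ω 𝔤)
    (L : LieTwoAlgebra 𝔤 𝔥) (hL : L.IsMinimal) (p : M)
    (hω : ¬ IsCECoboundary (trivialRep 𝔤) (A.omegaThree p))
    (hc : IsCECoboundary hL.redRep L.cRed) :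
    IsEmpty (MomentMap A L) := by
  refine ⟨fun F ↦ hω ?_⟩
  obtain ⟨η, hη⟩ := hc
  refine ⟨(SmoothFunction.evalAt p).compAlternatingMap F.two
    - (F.evalRed hL p).compAlternatingMap η, fun x y z ↦ ?_⟩
  have swap (a b : 𝔤) : F.two ![a, b] p = -F.two ![b, a] p := by
    have h : F.two ![a, b] = -F.two ![b, a] := by
      rw [← F.two.map_swap _ (show (0 : Fin 2) ≠ 1 by decide)]
      congr 1; ext i; fin_cases i <;> rfl
    rw [h]; rfl
  rw [F.omegaThree_apply hL, hη, swap x, swap y, swap z]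
  simp only [hL.redRep_eq_zero, map_add, map_sub, map_zero, trivialRep, LieHom.zero_apply,
    LinearMap.zero_apply, AlternatingMap.sub_apply, LinearMap.compAlternatingMap_apply]
  simp only [SmoothFunction.evalAt, LinearMap.coe_mk, AddHom.coe_mk]
  ring
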